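/- **Setting.** A *triangulation of a square* is a finite oriented simplicial complex $T$ homeomorphic to a closed disk, whose boundary is a 4-cycle with vertices (corners) $\mathbf p,\mathbf q,\mathbf r,\mathbf s$, in the cyclic order given by the orientation; the other vertices are interior. A *constrained triangulation* is a pair $\mathcal T=(T,\mathcal C)$ with $\mathcal C$ a finite set of constraints $C=\mathrm{Vx}(S_C)$, each the vertex set of a set $S_C$ of triangles of $T$ that is connected in the dual graph, the sets $S_C$ being pairwise disjoint. A triangle is *dead* if some constraint contains all its vertices, and *living* otherwise. A *generic drawing* of $\mathcal T$ is an injective map $\rho:\mathrm{Vx}(T)\to\mathbf C^2$ such that $\rho(C)$ lies on a line $\ell_C$ for each $C\in\mathcal C$; $\rho(\mathbf p)+\rho(\mathbf r)=\rho(\mathbf q)+\rho(\mathbf s)$ and this parallelogram is non-degenerate; the vertices of each living triangle have non-collinear images; and $\ell_C\ne\ell_{C'}$ for distinct intersecting constraints $C,C'$. $\mathcal T$ is *drawable* if it has a generic drawing. Let $\le$ be a total order on $\mathrm{Vx}(T)$ with $\mathbf p\le\mathbf q\le\mathbf s\le\mathbf r\le v$ for every interior $v$. A constraint $C$ is *relevant*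 to an interior vertex $v$ if $v\in C$ and $C$ contains at least three vertices $w\le v$. Put $\alpha_{\mathbf p}=\alpha_{\mathbf q}=\alpha_{\mathbf s}=2$, $\alpha_{\mathbf r}=0$, and $\alpha_v=2-\#\{C\in\mathcal C: C\text{ relevant to }v\}$ for $v$ interior. The order is a *drawing order* if $\alpha_v\ge0$ for all $v$. The *parameter field* $U$ is the field of rational functions over $\mathbf Q$ in $\sum_v\alpha_v$ variables, $\alpha_v$ of them attached to each vertex $v$. The parameterization $g=g_\le$ consists of points $g_v\in U^2$, defined along the order: if $v\neq\mathbf r$ and $\alpha_v=2$, then $g_v$ is the pair of variables of $v$; $g_{\mathbf r}=g_{\mathbf q}+g_{\mathbf s}-g_{\mathbf p}$; if $\alpha_v=1$, then $g_v=x_v g_y+(1-x_v)g_z$, where $x_v$ is the variable of $v$ and $y,z$ are the first two vertices of the relevant constraint; if $v$ is interior and $\alpha_v=0$, then $g_v$ is the intersection point (by Cramer's rule) of the lines $g_yg_z$ and $g_{y'}g_{z'}$, where $y,z$ and $y',z'$ are the first two vertices of the two relevant constraints. **Theorem (Monsky++).** Let $\mathcal T=(T,\mathcal C)$ be a drawable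 constrained triangulation of a square, and let $\le$ be a drawing order with parameter field $U$. For each living triangle $\Delta_j$ ($1\le j\le n$) let $W_j\in U$ be the oriented area of the triangle formed by the points $g_v$ for the vertices $v$ of $\Delta_j$, and let $\sigma=\sum_{j=1}^n W_j$. Then there are an integer $e\ge0$ and a homogeneous polynomial $f$ of degree $e$ in $n$ variables with integer coefficients such that $$2f(W_1,\dots,W_n)=\sigma^e\quad\text{in }U.$$ Moreover, let $S=\mathbf Q(x_v,y_v: v\in\mathrm{Vx}(T)\setminus\{\mathbf r\})$, put $(x_{\mathbf r},y_{\mathbf r})=(x_{\mathbf q}+x_{\mathbf s}-x_{\mathbf p},\,y_{\mathbf q}+y_{\mathbf s}-y_{\mathbf p})$, and let $Z_1,\dots,Z_m\in S$ be the oriented areas of all triangles (living and dead) of $T$ with vertices at the points $(x_v,y_v)$. Then there are an integer $e\ge 0$ and a homogeneous integer polynomial $f_T$ of degree $e$ with $2f_T(Z_1,\dots,Z_m)=(Z_1+\dots+Z_m)^e$ in $S$. For every homogeneous integer polynomial $f_T$ and every $e\ge0$ satisfying this equation, the polynomial $f$ obtained from $f_T$ by setting the variables of the dead triangles to $0$ is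 homogeneous (of the same degree as $f_T$) and satisfies $2f(W_1,\dots,W_n)=\sigma^e$ in $U$. -/

import Mathlib

/-! ### Triangulations of a square -/

/-- The triangles (2-dimensional faces) of an abstract simplicial complex. -/
abbrev AbstractSimplicialComplex.Triangle {V : Type*} (K : AbstractSimplicialComplex V) : Type _ :=
  {t : Finset V // t ∈ K.faces ∧ t.card = 3}

/-- The geometric realization of a finite abstract simplicial complex: the points of the standard
simplex (given by barycentric coordinates) whose support is contained in a face. -/
def AbstractSimplicialComplex.realization {V : Type*} [Fintype V]
    (K : AbstractSimplicialComplex V) : Set (V → ℝ) :=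
  {x | x ∈ stdSimplex ℝ V ∧ ∃ f ∈ K.faces, ∀ v, x v ≠ 0 → v ∈ f}

/-- The dual graph of a complex: two distinct triangles are adjacent if they share an edge. -/
def AbstractSimplicialComplex.dualGraph {V : Type*} (K : AbstractSimplicialComplex V) :
    SimpleGraph K.Triangle where
  Adj t t' := t ≠ t' ∧ ∃ a b : V, a ≠ b ∧ (a ∈ t.1 ∧ b ∈ t.1) ∧ (a ∈ t'.1 ∧ b ∈ t'.1)
  symm := ⟨fun _ _ h => ⟨h.1.symm, by obtain ⟨-, a, b, hab, h1, h2⟩ := h; exact ⟨a, b, hab, h2, h1⟩⟩⟩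
  loopless := ⟨fun _ h => h.1 rfl⟩

noncomputable instance AbstractSimplicialComplex.fintypeTriangle {V : Type*} [Fintype V]
    (K : AbstractSimplicialComplex V) : Fintype K.Triangle :=
  Fintype.ofFinite _

/-- A triangulation of a square: an oriented simplicial complex on the vertex set `V`, homeomorphic
to a closed disk, whose boundary is a 4-cycle `p, q, r, s` (in the cyclic order determined by the
orientation). -/
structure SquareTriangulation (V : Type*) [Fintype V] extends AbstractSimplicialComplex V where
  /-- The complex is homeomorphic to a disk. -/
  disk : Nonempty (toAbstractSimplicialComplex.realization ≃ₜ
    Metric.closedBall (0 : EuclideanSpace ℝ (Fin 2)) 1)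
  /-- The orientation: each triangle comes with a listing of its vertices in cyclic order (only the
  cyclic order matters). The oriented edges of `t` are the pairs `(orient t i, orient t (i + 1))`. -/
  orient : toAbstractSimplicialComplex.Triangle → Fin 3 → V
  mem_iff_orient : ∀ t v, v ∈ t.1 ↔ ∃ i, orient t i = v
  /-- The orientations of neighbouring triangles are compatible: no two triangles induce the same
  orientation on a common edge. -/
  orient_compatible : ∀ t t' i j, orient t i = orient t' j → orient t (i + 1) = orient t' (j + 1) →
    t = t'
  /-- The first corner. -/
  p : V
  /-- The second corner. -/
  q : V
  /-- The third corner. -/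
  r : V
  /-- The fourth corner. -/
  s : V
  corners_nodup : [p, q, r, s].Nodup
  /-- The boundary edges (those that lie in a single triangle), with the induced orientation, are
  `pq`, `qr`, `rs` and `sp`. -/
  boundary_iff : ∀ a b : V,
    ((∃ t i, orient t i = a ∧ orient t (i + 1) = b) ∧
      ¬ (∃ t i, orient t i = b ∧ orient t (i + 1) = a)) ↔
    (a = p ∧ b = q) ∨ (a = q ∧ b = r) ∨ (a = r ∧ b = s) ∨ (a = s ∧ b = p)

/-! ### Constrained triangulations and their drawings -/

/-- A constrained triangulation of a square: a triangulation of a square with a finite set of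
(collinearity) constraints. Each constraint `C` is the set of vertices of a contiguous set `S C` of
triangles, and the sets `S C` are pairwise disjoint (the constraints themselves need not be). -/
structure ConstrainedTriangulation (V : Type*) [Fintype V] extends SquareTriangulation V where
  constraints : Finset (Finset V)
  contiguous : ∃ S : Finset V → Set toAbstractSimplicialComplex.Triangle,
    (∀ C ∈ constraints, (toAbstractSimplicialComplex.dualGraph.induce (S C)).Connected ∧
      ∀ v, v ∈ C ↔ ∃ t ∈ S C, v ∈ t.1) ∧
    (constraints : Set (Finset V)).PairwiseDisjoint S

namespace ConstrainedTriangulation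

variable {V : Type*} [Fintype V] (T : ConstrainedTriangulation V)

/-- A triangle is alive if no constraint contains all of its vertices. -/
def IsAlive (t : T.Triangle) : Prop := ∀ C ∈ T.constraints, ¬ t.1 ⊆ C

/-- The living triangles. -/
abbrev LivingTriangle : Type _ := {t : T.Triangle // T.IsAlive t}

noncomputable instance : Fintype T.LivingTriangle := Fintype.ofFinite _

/-- A drawing: the vertices of each constraint go to points on a common line, and the corners go to
a (possibly degenerate) parallelogram. -/
structure IsDrawing (ρ : V → ℂ × ℂ) : Prop where
  collinear : ∀ C ∈ T.constraints, Collinear ℂ (ρ '' (C : Set V))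
  parallelogram : ρ T.p + ρ T.r = ρ T.q + ρ T.s

/-- A generic drawing. Since `ρ` is injective, each constraint spans a unique line, and the lines
of two constraints coincide exactly if the union of the two is mapped into a line. -/
structure IsGenericDrawing (ρ : V → ℂ × ℂ) : Prop extends T.IsDrawing ρ where
  nondegenerate : ¬ Collinear ℂ {ρ T.p, ρ T.q, ρ T.r} ∧ ¬ Collinear ℂ {ρ T.q, ρ T.r, ρ T.s} ∧
    ¬ Collinear ℂ {ρ T.r, ρ T.s, ρ T.p} ∧ ¬ Collinear ℂ {ρ T.s, ρ T.p, ρ T.q}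
  alive : ∀ t : T.Triangle, T.IsAlive t → ¬ Collinear ℂ (ρ '' (t.1 : Set V))
  injective : Function.Injective ρ
  lines_ne : ∀ C ∈ T.constraints, ∀ C' ∈ T.constraints, C ≠ C' → (∃ v, v ∈ C ∧ v ∈ C') →
    ¬ Collinear ℂ (ρ '' ((C : Set V) ∪ (C' : Set V)))

/-- A constrained triangulation is drawable if it has a generic drawing. -/
def Drawable : Prop := ∃ ρ : V → ℂ × ℂ, T.IsGenericDrawing ρ

end ConstrainedTriangulation

/-! ### Plane geometry over a field -/

section Plane

variable {K : Type*} [Field K]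

/-- The determinant of two vectors of the plane. -/
def planeDet (a b : K × K) : K := a.1 * b.2 - a.2 * b.1

/-- The (oriented) area of the triangle with vertices `a`, `b`, `c`. -/
def triangleArea (a b c : K × K) : K := planeDet (b - a) (c - a) / 2

/-- The intersection of the line through `a`, `b` with the line through `a'`, `b'`, computed by
Cramer's rule. -/
def lineIntersection (a b a' b' : K × K) : K × K :=
  a + (planeDet (a' - a) (b' - a') / planeDet (b - a) (b' - a')) • (b - a)

end Plane

namespace SquareTriangulation

variable {V : Type*} [Fintype V] (T : SquareTriangulation V)

/-! ### The coordinate function field of the honest triangulation -/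

/-- The area of the oriented triangle `t` if the vertices are placed at the points `P v`. -/
def area {K : Type*} [Field K] (P : V → K × K) (t : T.Triangle) : K :=
  triangleArea (P (T.orient t 0)) (P (T.orient t 1)) (P (T.orient t 2))

/-- The field of rational functions over `ℚ` in the variables `x_v, y_v` for all vertices `v ≠ r`
(the variables `(v, 0)` and `(v, 1)` stand for `x_v` and `y_v`). -/
abbrev CoordinateField : Type _ := FractionRing (MvPolynomial ({v : V // v ≠ T.r} × Fin 2) ℚ)

open Classical in
/-- The point `(x_v, y_v)` of a vertex `v ≠ r` (and `0` for `v = r`). -/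
noncomputable def freePoint (v : V) : T.CoordinateField × T.CoordinateField :=
  if h : v ≠ T.r then
    (algebraMap _ _ (MvPolynomial.X (⟨v, h⟩, 0) : MvPolynomial ({v : V // v ≠ T.r} × Fin 2) ℚ),
      algebraMap _ _ (MvPolynomial.X (⟨v, h⟩, 1) : MvPolynomial ({v : V // v ≠ T.r} × Fin 2) ℚ))
  else 0

open Classical in
/-- The point `(x_v, y_v)` of any vertex, where `(x_r, y_r)` is the fourth vertex of the
parallelogram. -/
noncomputable def coordinatePoint (v : V) : T.CoordinateField × T.CoordinateField :=
  if v = T.r then T.freePoint T.q + T.freePoint T.s - T.freePoint T.p else T.freePoint v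

/-- `Z_t`: the area of the triangle `t` as an element of the coordinate field. -/
noncomputable def Z (t : T.Triangle) : T.CoordinateField := T.area T.coordinatePoint t

end SquareTriangulation

/-- The first element of `C` (and `v` if `C` is empty). -/
def Finset.firstOf {V : Type*} [LinearOrder V] (C : Finset V) (v : V) : V := C.min.untopD v

/-- The second element of `C` (and `v` if there is none). -/
def Finset.secondOf {V : Type*} [LinearOrder V] (C : Finset V) (v : V) : V :=
  (C.erase (C.firstOf v)).firstOf v

/-! ### Drawing orders and the parameterization

The total order on the vertices is the given linear order on `V`. -/

namespace ConstrainedTriangulation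

variable {V : Type*} [Fintype V] [LinearOrder V] (T : ConstrainedTriangulation V)

/-- The constraints that are relevant to `v`: those that contain `v` and at least three vertices
up to and including `v`. -/
def relevant (v : V) : Finset (Finset V) :=
  T.constraints.filter fun C => v ∈ C ∧ 3 ≤ (C.filter (· ≤ v)).card

/-- The (expected) number of degrees of freedom in placing `v`. -/
def alpha (v : V) : ℤ :=
  if v = T.p ∨ v = T.q ∨ v = T.s then 2
  else if v = T.r then 0
  else 2 - ((T.relevant v).card : ℤ)

/-- The linear order on `V` is a drawing order: the corners come first, in the order `p, q, s, r`,
and `alpha` is nonnegative on the interior vertices. -/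
structure IsDrawingOrder : Prop where
  p_le_q : T.p ≤ T.q
  q_le_s : T.q ≤ T.s
  s_le_r : T.s ≤ T.r
  r_le : ∀ v, v ≠ T.p → v ≠ T.q → v ≠ T.s → T.r ≤ v
  alpha_nonneg : ∀ v, v ≠ T.p → v ≠ T.q → v ≠ T.r → v ≠ T.s → 0 ≤ T.alpha v

/-- The parameters: `alpha v` of them for each vertex `v`. -/
abbrev Parameter : Type _ := (v : V) × Fin (T.alpha v).toNat

/-- The parameter field: rational functions over `ℚ` in the parameters. -/
abbrev ParameterField : Type _ := FractionRing (MvPolynomial T.Parameter ℚ)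

/-- The `i`-th parameter of the vertex `v`, counted from `0` (and `0` if there is none). -/
noncomputable def param (v : V) (i : ℕ) : T.ParameterField :=
  if h : i < (T.alpha v).toNat then
    algebraMap (MvPolynomial T.Parameter ℚ) T.ParameterField (MvPolynomial.X ⟨v, ⟨i, h⟩⟩)
  else 0

/-- The position of `v`, given the positions `g w` of the earlier vertices `w < v`.
The cases of no, one and two relevant constraints are the cases `alpha v = 2, 1, 0`. -/
noncomputable def place (v : V) (g : V → T.ParameterField × T.ParameterField) :
    T.ParameterField × T.ParameterField :=
  if v = T.p ∨ v = T.q ∨ v = T.s then (T.param v 0, T.param v 1)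
  else if v = T.r then g T.q + g T.s - g T.p
  else
    match (T.relevant v).toList with
    | [] => (T.param v 0, T.param v 1)
    | [C] => T.param v 0 • g (C.firstOf v) + (1 - T.param v 0) • g (C.secondOf v)
    | [C, C'] => lineIntersection (g (C.firstOf v)) (g (C.secondOf v))
        (g (C'.firstOf v)) (g (C'.secondOf v))
    | _ => 0

/-- The parameterization `g`: its coordinate functions `g v`, defined by recursion along the
order. -/
noncomputable def parameterization : V → T.ParameterField × T.ParameterField :=
  WellFoundedLT.fix fun v ih =>
    T.place v fun w => if h : w < v then ih w h else 0

/-- `W_t`: the area of the living triangle `t` as an element of the parameter field. -/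
noncomputable def W (t : T.LivingTriangle) : T.ParameterField := T.area T.parameterization t.1

end ConstrainedTriangulation

open Classical in
/-- Setting the variables of the dead triangles to zero. -/
noncomputable def ConstrainedTriangulation.killDead {V : Type*} [Fintype V]
    (T : ConstrainedTriangulation V) (f : MvPolynomial T.Triangle ℤ) :
    MvPolynomial T.LivingTriangle ℤ :=
  MvPolynomial.aeval
    (fun t => if h : T.IsAlive t then (MvPolynomial.X ⟨t, h⟩ : MvPolynomial T.LivingTriangle ℤ)
      else 0) f

/-! ### Summation over oriented edges -/

namespace SquareTriangulation

variable {V : Type*} [Fintype V] (T : SquareTriangulation V)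

/-! For an honest triangulation the equation is Monsky's argument with valuations. Let the vertices
be points over a field with `2 ≠ 0`, the corners forming a parallelogram of area `σ ≠ 0`, and
consider the ring generated by the quotients area / `σ`. If 2 were not a unit in it, some valuation
ring would contain it with 2 among the nonunits. Colour the vertices by this valuation in affine
coordinates that make the square the unit square. Sperner's lemma gives a triangle with three
colours, and for that one 2 · area / `σ` has valuation at least 1 (`exists_one_le_valuation_area`),
a contradiction. So 2 has an inverse that is an integer polynomial in the quotients, and
homogenizing it with the sum of the variables gives `fT` (`exists_monsky_polynomial`).

For a constrained triangulation, specialize the coordinates of the vertices to the parameterization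
`g`. The equation persists (`eval₂_area_of_eval₂_Z`). If the dead triangles have area 0 at `g`, then
their variables can be set to 0 and they drop out of the sum, which leaves the equation for the
living triangles.

It remains to see that `g` satisfies the constraints. This is clear from its construction unless a
denominator in Cramer's rule vanishes or the first two points of a constraint coincide. Here
drawability enters: by induction along the order, a generic drawing is a value of `g` at suitable
parameters (`exists_pointEvalsTo`). A rational function with a nonzero value is nonzero, so the
denominators and the differences of points that are nonzero in the drawing are nonzero in the
parameter field. -/

theorem orient_injective (t : T.Triangle) : Function.Injective (T.orient t) := by
  classical
  have h : t.1 = Finset.univ.image (T.orient t) := by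
    ext v
    simp [T.mem_iff_orient t v]
  rw [← Set.injOn_univ, ← Finset.coe_univ, ← Finset.card_image_iff, ← h, t.2.2]
  rfl

/-- The sum of an antisymmetric function over the oriented edges of all triangles is its sum over
the boundary edges. -/
theorem sum_edges {M : Type*} [AddCommGroup M] (f : V → V → M) (hf : ∀ a b, f a b + f b a = 0) :
    ∑ t, ∑ i, f (T.orient t i) (T.orient t (i + 1)) =
      f T.p T.q + f T.q T.r + f T.r T.s + f T.s T.p := by
  classical
  -- By `orient_compatible` each oriented edge occurs only once, so the double sum runs over a set
  -- `E` of oriented edges. The edges whose reverse is also in `E` are the interior ones.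
  let edge : T.Triangle × Fin 3 → V × V := fun x => (T.orient x.1 x.2, T.orient x.1 (x.2 + 1))
  have hinj : Function.Injective edge := by
    rintro ⟨t, i⟩ ⟨t', j⟩ h
    obtain ⟨h1, h2⟩ := Prod.mk.inj h
    obtain rfl := T.orient_compatible t t' i j h1 h2
    exact congrArg _ (T.orient_injective t h1)
  let E : Finset (V × V) := Finset.univ.image edge
  have hE : ∀ a b, (a, b) ∈ E ↔ ∃ t i, T.orient t i = a ∧ T.orient t (i + 1) = b := by
    simp [E, edge]
  have hb : E.filter (fun e => e.swap ∉ E) =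
      {(T.p, T.q), (T.q, T.r), (T.r, T.s), (T.s, T.p)} := by
    ext ⟨a, b⟩
    rw [Finset.mem_filter, Prod.swap_prod_mk, hE, hE, T.boundary_iff]
    simp
  -- Interior edges cancel against their reverses. A fixed point of the swap would be a loop, which
  -- `orient_injective` excludes.
  have hint : ∑ e ∈ E.filter (fun e => e.swap ∈ E), f e.1 e.2 = 0 := by
    refine Finset.sum_involution (fun e _ => e.swap) (fun e _ => hf _ _) ?_ ?_ (fun _ _ => rfl)
    · rintro ⟨a, b⟩ he - h
      obtain ⟨t, i, h1, h2⟩ := (hE a b).1 (Finset.mem_filter.1 he).1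
      have : b = a := (Prod.mk.inj h).1
      subst this
      have := T.orient_injective t (h1.trans h2.symm)
      revert this
      fin_cases i <;> decide
    · intro e he
      simpa [and_comm] using he
  have hnd := T.corners_nodup
  simp only [List.nodup_cons, List.mem_cons, List.not_mem_nil, not_or, or_false] at hnd
  rw [← Fintype.sum_prod_type' (fun t i => f (T.orient t i) (T.orient t (i + 1)))]
  calc ∑ x : T.Triangle × Fin 3, f (T.orient x.1 x.2) (T.orient x.1 (x.2 + 1))
      = ∑ e ∈ E, f e.1 e.2 := (Finset.sum_image (f := fun e => f e.1 e.2) hinj.injOn).symm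
    _ = f T.p T.q + f T.q T.r + f T.r T.s + f T.s T.p := by
      rw [← Finset.sum_filter_add_sum_filter_not E (fun e => e.swap ∈ E), hint, zero_add, hb,
        Finset.sum_insert, Finset.sum_insert, Finset.sum_insert, Finset.sum_singleton]
      · simp only [add_assoc]
      all_goals simp [Prod.ext_iff]; grind

/-- Shoelace formula: each area is half the sum of an antisymmetric function over the oriented
edges, so only the boundary of the parallelogram contributes. -/
theorem sum_area {K : Type*} [Field K] [NeZero (2 : K)] (P : V → K × K)
    (hP : P T.r = P T.q + P T.s - P T.p) :
    ∑ t, T.area P t = planeDet (P T.q - P T.p) (P T.s - P T.p) := by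
  have h := T.sum_edges (fun a b => planeDet (P a) (P b)) (fun a b => by simp only [planeDet]; ring)
  have h2 : ∀ t, T.area P t =
      (∑ i, planeDet (P (T.orient t i)) (P (T.orient t (i + 1)))) / 2 := by
    intro t
    rw [Fin.sum_univ_three]
    simp only [area, triangleArea, planeDet, Prod.fst_sub, Prod.snd_sub, zero_add,
      show (1 + 1 : Fin 3) = 2 from rfl, show (2 + 1 : Fin 3) = 0 from rfl]
    ring
  rw [Finset.sum_congr rfl fun t _ => h2 t, ← Finset.sum_div, h, div_eq_iff two_ne_zero, hP]
  simp only [planeDet, Prod.fst_sub, Prod.snd_sub, Prod.fst_add, Prod.snd_add]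
  ring

/-- Sperner's lemma: if the corners `p, q, r, s` have the colours `0, 1, 1, 2`, then some triangle
has vertices of all three colours. -/
theorem exists_rainbow (c : V → Fin 3) (hp : c T.p = 0) (hq : c T.q = 1) (hr : c T.r = 1)
    (hs : c T.s = 2) :
    ∃ t : T.Triangle, ∃ σ : Equiv.Perm (Fin 3), ∀ i, c (T.orient t (σ i)) = i := by
  -- Signed count of the edges coloured 0, 1. On the boundary only `pq` contributes, so the total is
  -- 1 and some triangle has a nonzero count. This forces three colours, since with at most two
  -- colours the count around a triangle is 0.
  let g : Fin 3 → Fin 3 → ℤ := fun x y =>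
    if x = 0 ∧ y = 1 then 1 else if x = 1 ∧ y = 0 then -1 else 0
  have h := T.sum_edges (fun a b => g (c a) (c b)) (fun a b => by
    generalize c a = x; generalize c b = y; revert x y; decide)
  simp only [hp, hq, hr, hs] at h
  have hne : ∑ t, ∑ i, g (c (T.orient t i)) (c (T.orient t (i + 1))) ≠ 0 := by
    rw [h]; decide
  obtain ⟨t, -, ht⟩ := Finset.exists_ne_zero_of_sum_ne_zero hne
  refine ⟨t, ?_⟩
  rw [Fin.sum_univ_three] at ht
  have key : Function.Injective fun i => c (T.orient t i) := by
    have : ∀ x y z : Fin 3, g x y + g y z + g z x ≠ 0 → x ≠ y ∧ y ≠ z ∧ x ≠ z := by decide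
    obtain ⟨h1, h2, h3⟩ := this _ _ _ ht
    intro i j hij
    fin_cases i <;> fin_cases j <;> simp_all
  let τ := Equiv.ofBijective _ (Finite.injective_iff_bijective.1 key)
  exact ⟨τ.symm, τ.apply_symm_apply⟩

/-- Permuting the vertices changes the area of a triangle at most by a sign. -/
theorem area_perm {K : Type*} [Field K] (P : V → K × K) (t : T.Triangle)
    (σ : Equiv.Perm (Fin 3)) :
    let A := triangleArea (P (T.orient t (σ 0))) (P (T.orient t (σ 1))) (P (T.orient t (σ 2)))
    T.area P t = A ∨ T.area P t = -A := by
  have h01 : σ 0 ≠ σ 1 := by simp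
  have h02 : σ 0 ≠ σ 2 := by simp
  have h12 : σ 1 ≠ σ 2 := by simp
  simp only [area, triangleArea, planeDet, Prod.fst_sub, Prod.snd_sub]
  generalize σ 0 = i at *
  generalize σ 1 = j at *
  generalize σ 2 = k at *
  fin_cases i <;> fin_cases j <;> fin_cases k <;> simp at h01 h02 h12 <;>
    first
    | (left; simp <;> ring1)
    | (right; simp; ring1)

end SquareTriangulation

/-! ### Monsky's colouring -/

section Valuation

variable {K Γ : Type*} [Field K] [LinearOrderedCommGroupWithZero Γ] (v : Valuation K Γ)

open Classical in
/-- Monsky's colouring of the plane associated with a valuation. -/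
noncomputable def monskyColor (a : K × K) : Fin 3 :=
  if v a.1 < 1 ∧ v a.2 < 1 then 0 else if v a.2 ≤ v a.1 then 1 else 2

/-- Subtracting `a`, whose coordinates have valuation below 1, does not change the valuation of the
dominant coordinates `b.1` and `c.2`. Their product strictly dominates the other term of the
determinant, so by the ultrametric inequality the determinant has valuation `v b.1 * v c.2`. -/
theorem one_le_valuation_planeDet {a b c : K × K} (ha : monskyColor v a = 0)
    (hb : monskyColor v b = 1) (hc : monskyColor v c = 2) : 1 ≤ v (planeDet (b - a) (c - a)) := by
  have ha' : v a.1 < 1 ∧ v a.2 < 1 := by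
    unfold monskyColor at ha
    split_ifs at ha with h1 h2
    · exact h1
    all_goals simp at ha
  have hb' : 1 ≤ v b.1 ∧ v b.2 ≤ v b.1 := by
    unfold monskyColor at hb
    split_ifs at hb with h1 h2
    · simp at hb
    · refine ⟨not_lt.1 fun h => h1 ⟨h, h2.trans_lt h⟩, h2⟩
    · simp at hb
  have hc' : 1 ≤ v c.2 ∧ v c.1 < v c.2 := by
    unfold monskyColor at hc
    split_ifs at hc with h1 h2
    · simp at hc
    · simp at hc
    · rw [not_le] at h2
      exact ⟨not_lt.1 fun h => h1 ⟨h2.trans h, h⟩, h2⟩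
  have e1 : v (b.1 - a.1) = v b.1 := v.map_sub_eq_of_lt_left (ha'.1.trans_le hb'.1)
  have e2 : v (c.2 - a.2) = v c.2 := v.map_sub_eq_of_lt_left (ha'.2.trans_le hc'.1)
  have e3 : v (b.2 - a.2) ≤ v b.1 :=
    (v.map_sub _ _).trans (max_le hb'.2 (ha'.2.le.trans hb'.1))
  have e4 : v (c.1 - a.1) < v c.2 :=
    (v.map_sub _ _).trans_lt (max_lt hc'.2 (ha'.1.trans_le hc'.1))
  have e5 : v ((b.2 - a.2) * (c.1 - a.1)) < v ((b.1 - a.1) * (c.2 - a.2)) := by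
    rw [map_mul, map_mul, e1, e2]
    exact (mul_le_mul_left e3 _).trans_lt
      (mul_lt_mul_of_pos_left e4 (zero_lt_one.trans_le hb'.1))
  rw [planeDet, Prod.fst_sub, Prod.snd_sub, Prod.fst_sub, Prod.snd_sub,
    v.map_sub_eq_of_lt_left e5, map_mul, e1, e2]
  exact one_le_mul hb'.1 hc'.1

end Valuation

/-! ### Monsky's theorem over a field -/

namespace SquareTriangulation

variable {V : Type*} [Fintype V] (T : SquareTriangulation V)

/-- In an affine coordinate system that turns the corners into the unit square, some triangle has
area of valuation at least that of `1 / 2`. -/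
theorem exists_one_le_valuation_area {K Γ : Type*} [Field K] [LinearOrderedCommGroupWithZero Γ]
    [NeZero (2 : K)] (v : Valuation K Γ) (P : V → K × K) (hP : P T.r = P T.q + P T.s - P T.p)
    (hσ : ∑ t, T.area P t ≠ 0) :
    ∃ t, 1 ≤ v (2 * (T.area P t / ∑ t, T.area P t)) := by
  rw [T.sum_area P hP] at *
  set D := planeDet (P T.q - P T.p) (P T.s - P T.p) with hD
  -- Cramer's rule for the coordinates with origin `p` and basis vectors `q - p`, `s - p`. The
  -- corners `p, q, r, s` then get the colours 0, 1, 1, 2, and areas are divided by `D`, which is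
  -- the total area.
  let Q : V → K × K := fun w =>
    (planeDet (P w - P T.p) (P T.s - P T.p) / D, planeDet (P T.q - P T.p) (P w - P T.p) / D)
  have hQp : Q T.p = (0, 0) := by simp [Q, planeDet]
  have hQq : Q T.q = (1, 0) := by
    refine Prod.ext (div_self hσ) ?_
    simp [Q, planeDet, mul_comm]
  have hQs : Q T.s = (0, 1) := by
    refine Prod.ext ?_ (div_self hσ)
    simp [Q, planeDet, mul_comm]
  have hQr : Q T.r = (1, 1) := by
    refine Prod.ext ?_ ?_
    all_goals
      simp only [Q, hP]
      rw [div_eq_one_iff_eq hσ, hD]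
      simp only [planeDet, Prod.fst_sub, Prod.snd_sub, Prod.fst_add, Prod.snd_add]
      ring
  have hdet : ∀ a b c, planeDet (Q b - Q a) (Q c - Q a) = planeDet (P b - P a) (P c - P a) / D := by
    intro a b c
    simp only [Q, planeDet, Prod.fst_sub, Prod.snd_sub]
    rw [eq_div_iff hσ]
    field_simp
    simp only [hD, planeDet, Prod.fst_sub, Prod.snd_sub]
    ring
  obtain ⟨t, σ, ht⟩ := T.exists_rainbow (fun w => monskyColor v (Q w))
    (by simp [hQp, monskyColor]) (by simp [hQq, monskyColor]) (by simp [hQr, monskyColor])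
    (by simp [hQs, monskyColor])
  refine ⟨t, (one_le_valuation_planeDet v (ht 0) (ht 1) (ht 2)).trans_eq ?_⟩
  rw [hdet]
  rcases T.area_perm P t σ with h | h <;> rw [h, triangleArea]
  · congr 1; field_simp
  · rw [← Valuation.map_neg]; congr 1; field_simp

/-- Monsky's theorem for triangulations whose vertices lie in a plane over any field in which
`2 ≠ 0`. -/
theorem exists_monsky_polynomial {K : Type*} [Field K] [NeZero (2 : K)] (P : V → K × K)
    (hP : P T.r = P T.q + P T.s - P T.p) :
    ∃ (f : MvPolynomial T.Triangle ℤ) (e : ℕ), f.IsHomogeneous e ∧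
      2 * MvPolynomial.eval₂ (Int.castRingHom K) (T.area P) f = (∑ t, T.area P t) ^ e := by
  by_cases hσ : ∑ t, T.area P t = 0
  -- The exponent has to be positive, because `0 ^ 0 = 1`.
  · exact ⟨0, 1, MvPolynomial.isHomogeneous_zero _ _ _, by simp [hσ]⟩
  set σ := ∑ t, T.area P t with hσdef
  let φ : MvPolynomial T.Triangle ℤ →+* K :=
    MvPolynomial.eval₂Hom (Int.castRingHom K) fun t => T.area P t / σ
  -- 2 is a unit in the range of `φ`. Otherwise it lies in a proper ideal, and there is a valuation
  -- ring `B` of `K` that contains the range and has 2 as a nonunit. Then 2 · area / `σ` has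
  -- valuation below 1 for every triangle.
  obtain ⟨h, hh⟩ : ∃ h, 2 * φ h = 1 := by
    by_contra! hno
    have hI : Ideal.span {(2 : φ.range)} ≠ ⊤ := by
      rw [Ne, Ideal.span_singleton_eq_top, isUnit_iff_exists_inv]
      rintro ⟨⟨_, h, rfl⟩, hb⟩
      exact hno h (congrArg Subtype.val hb)
    obtain ⟨B, hB, h2⟩ := Ideal.image_subset_nonunits_valuationSubring _ hI
    obtain ⟨t, ht⟩ := T.exists_one_le_valuation_area B.valuation P hP hσ
    have h2' : B.valuation 2 < 1 :=
      B.mem_nonunits_iff.1 (h2 ⟨2, Ideal.subset_span rfl, rfl⟩)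
    have h3 : B.valuation (T.area P t / σ) ≤ 1 :=
      (B.valuation_le_one_iff _).2 (hB ⟨MvPolynomial.X t, by simp [φ]⟩)
    rw [map_mul] at ht
    exact (mul_lt_one_of_lt_of_le h2' h3).not_ge ht
  let S : MvPolynomial T.Triangle ℤ := ∑ t, MvPolynomial.X t
  have hS : MvPolynomial.eval₂ (Int.castRingHom K) (T.area P) S = σ := by
    simp [S, MvPolynomial.eval₂_sum, hσdef]
  have hS1 : S.IsHomogeneous 1 :=
    MvPolynomial.IsHomogeneous.sum _ _ _ fun t _ => MvPolynomial.isHomogeneous_X _ _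
  -- Homogenization of `h` to its total degree, with `S`, whose value is `σ`, as the homogenizing
  -- form.
  refine ⟨∑ i ∈ Finset.range (h.totalDegree + 1),
    S ^ (h.totalDegree - i) * MvPolynomial.homogeneousComponent i h, h.totalDegree, ?_, ?_⟩
  · refine MvPolynomial.IsHomogeneous.sum _ _ _ fun i hi => ?_
    have := (hS1.pow (h.totalDegree - i)).mul (MvPolynomial.homogeneousComponent_isHomogeneous i h)
    convert this using 1
    have := Finset.mem_range.1 hi
    lia
  -- Passing from the quotients area / `σ` back to the areas multiplies the component of degree `i`
  -- by `σ ^ i`.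
  · have hcomp : ∀ i, MvPolynomial.eval₂ (Int.castRingHom K) (T.area P)
        (MvPolynomial.homogeneousComponent i h) =
          σ ^ i * φ (MvPolynomial.homogeneousComponent i h) := by
      intro i
      have hhom := MvPolynomial.homogeneousComponent_isHomogeneous i h
      simp only [φ, MvPolynomial.coe_eval₂Hom]
      rw [MvPolynomial.eval₂_eq', MvPolynomial.eval₂_eq', Finset.mul_sum]
      refine Finset.sum_congr rfl fun d hd => ?_
      have hdeg : ∑ t, d t = i := by
        have := hhom (MvPolynomial.mem_support_iff.1 hd)
        rwa [Finsupp.weight_apply, Finsupp.sum_fintype _ _ (by simp), Finset.sum_congr rfl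
          fun t _ => by rw [Pi.one_apply, smul_eq_mul, mul_one]] at this
      rw [← hdeg, ← Finset.prod_pow_eq_pow_sum, mul_left_comm, ← Finset.prod_mul_distrib]
      congr 1
      refine Finset.prod_congr rfl fun t _ => ?_
      rw [← mul_pow, mul_div_cancel₀ _ hσ]
    calc _ = 2 * ∑ i ∈ Finset.range (h.totalDegree + 1),
          σ ^ h.totalDegree * φ (MvPolynomial.homogeneousComponent i h) := by
          rw [MvPolynomial.eval₂_sum]
          congr 1
          refine Finset.sum_congr rfl fun i hi => ?_
          have := Finset.mem_range.1 hi
          rw [MvPolynomial.eval₂_mul, MvPolynomial.eval₂_pow, hS, hcomp, ← mul_assoc, ← pow_add,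
            Nat.sub_add_cancel (by lia)]
      _ = σ ^ h.totalDegree := by
          rw [← Finset.mul_sum, ← map_sum, MvPolynomial.sum_homogeneousComponent, mul_left_comm, hh,
            mul_one]

end SquareTriangulation

/-! ### Lines in the plane -/

section Plane

variable {K : Type*} [Field K]

theorem exists_eq_smul_of_planeDet_eq_zero {a b x : K × K} (hab : a ≠ b)
    (h : planeDet (b - a) (x - a) = 0) : ∃ c : K, x = a + c • (b - a) := by
  obtain ⟨a1, a2⟩ := a
  obtain ⟨b1, b2⟩ := b
  obtain ⟨x1, x2⟩ := x
  simp only [planeDet, Prod.mk_sub_mk] at h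
  by_cases h1 : b1 - a1 = 0
  · have h2 : b2 - a2 ≠ 0 := fun h2 => hab (by rw [sub_eq_zero.1 h1, sub_eq_zero.1 h2])
    refine ⟨(x2 - a2) / (b2 - a2), ?_⟩
    rw [h1, zero_mul, zero_sub, neg_eq_zero, mul_eq_zero, or_iff_right h2] at h
    simp [h1, div_mul_cancel₀ _ h2, sub_eq_zero.1 h]
  · refine ⟨(x1 - a1) / (b1 - a1), ?_⟩
    simp only [Prod.mk_sub_mk, Prod.smul_mk, smul_eq_mul, div_mul_cancel₀ _ h1, Prod.mk_add_mk,
      add_sub_cancel, Prod.mk.injEq, true_and]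
    field_simp
    linear_combination h

theorem collinear_of_planeDet_eq_zero {s : Set (K × K)} {a b : K × K} (hab : a ≠ b)
    (h : ∀ x ∈ s, planeDet (b - a) (x - a) = 0) : Collinear K s := by
  refine (collinear_iff_exists_forall_eq_smul_vadd s).2 ⟨a, b - a, fun x hx => ?_⟩
  obtain ⟨c, hc⟩ := exists_eq_smul_of_planeDet_eq_zero hab (h x hx)
  exact ⟨c, by rw [hc, vadd_eq_add, add_comm]⟩

theorem Collinear.planeDet_eq_zero {s : Set (K × K)} (hs : Collinear K s) {a b x : K × K}
    (ha : a ∈ s) (hb : b ∈ s) (hx : x ∈ s) : planeDet (b - a) (x - a) = 0 := by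
  obtain ⟨w, hw⟩ := (collinear_iff_of_mem ha).1 hs
  obtain ⟨c, rfl⟩ := hw b hb
  obtain ⟨d, rfl⟩ := hw x hx
  simp only [planeDet, vadd_eq_add, add_sub_cancel_right, Prod.smul_fst, Prod.smul_snd,
    smul_eq_mul]
  ring

theorem triangleArea_eq_zero_of_mem_line {y z a b c : K × K} (hyz : y ≠ z)
    (ha : planeDet (z - y) (a - y) = 0) (hb : planeDet (z - y) (b - y) = 0)
    (hc : planeDet (z - y) (c - y) = 0) : triangleArea a b c = 0 := by
  have h : Collinear K {x | planeDet (z - y) (x - y) = 0} :=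
    collinear_of_planeDet_eq_zero hyz fun x hx => hx
  rw [triangleArea, h.planeDet_eq_zero ha hb hc, zero_div]

theorem planeDet_lineIntersection_left (a b a' b' : K × K) :
    planeDet (b - a) (lineIntersection a b a' b' - a) = 0 := by
  simp only [planeDet, lineIntersection, add_sub_cancel_left, Prod.smul_fst, Prod.smul_snd,
    smul_eq_mul]
  ring

/-- Unlike for the first line, the hypothesis is essential: for a zero determinant the division
convention makes `lineIntersection` return `a`, which need not lie on the second line. -/
theorem planeDet_lineIntersection_right {a b a' b' : K × K}
    (h : planeDet (b - a) (b' - a') ≠ 0) :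
    planeDet (b' - a') (lineIntersection a b a' b' - a') = 0 := by
  obtain ⟨c, hc⟩ : ∃ c, c = planeDet (a' - a) (b' - a') / planeDet (b - a) (b' - a') := ⟨_, rfl⟩
  rw [lineIntersection, ← hc]
  rw [eq_div_iff h] at hc
  simp only [planeDet, Prod.fst_sub, Prod.snd_sub, Prod.fst_add, Prod.snd_add, Prod.smul_fst,
    Prod.smul_snd, smul_eq_mul] at hc ⊢
  linear_combination -hc

theorem eq_lineIntersection {a b a' b' x : K × K} (h : planeDet (b - a) (b' - a') ≠ 0)
    (h1 : planeDet (b - a) (x - a) = 0) (h2 : planeDet (b' - a') (x - a') = 0) :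
    x = lineIntersection a b a' b' := by
  have hab : a ≠ b := by
    rintro rfl
    simp [planeDet] at h
  obtain ⟨c, rfl⟩ := exists_eq_smul_of_planeDet_eq_zero hab h1
  have : c = planeDet (a' - a) (b' - a') / planeDet (b - a) (b' - a') := by
    rw [eq_div_iff h]
    simp only [planeDet, Prod.fst_sub, Prod.snd_sub, Prod.fst_add, Prod.snd_add, Prod.smul_fst,
      Prod.smul_snd, smul_eq_mul] at h2 ⊢
    linear_combination -h2
  rw [lineIntersection, ← this]

end Plane

/-! ### Values of rational functions -/

section EvalsTo

variable {R U L : Type*} [CommRing R] [Field U] [Algebra R U] [Field L]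

/-- The fraction `u` is defined at the point given by `φ` and takes the value `c` there. -/
def EvalsTo (φ : R →+* L) (u : U) (c : L) : Prop :=
  ∃ a b : R, φ b ≠ 0 ∧ u * algebraMap R U b = algebraMap R U a ∧ c * φ b = φ a

namespace EvalsTo

variable {φ : R →+* L} {u v : U} {c d : L}

theorem of_algebraMap (φ : R →+* L) (a : R) : EvalsTo φ (algebraMap R U a) (φ a) :=
  ⟨a, 1, by simp, by simp, by simp⟩

theorem one : EvalsTo φ (1 : U) 1 := by simpa using of_algebraMap (U := U) φ 1

theorem add (hu : EvalsTo φ u c) (hv : EvalsTo φ v d) : EvalsTo φ (u + v) (c + d) := by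
  obtain ⟨a, b, hb, h1, h2⟩ := hu
  obtain ⟨a', b', hb', h1', h2'⟩ := hv
  refine ⟨a * b' + a' * b, b * b', by simp [hb, hb'], ?_, ?_⟩
  · simp only [map_mul, map_add, ← h1, ← h1']; ring
  · simp only [map_mul, map_add, ← h2, ← h2']; ring

theorem mul (hu : EvalsTo φ u c) (hv : EvalsTo φ v d) : EvalsTo φ (u * v) (c * d) := by
  obtain ⟨a, b, hb, h1, h2⟩ := hu
  obtain ⟨a', b', hb', h1', h2'⟩ := hv
  refine ⟨a * a', b * b', by simp [hb, hb'], ?_, ?_⟩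
  · simp only [map_mul, ← h1, ← h1']; ring
  · simp only [map_mul, ← h2, ← h2']; ring

theorem neg (hu : EvalsTo φ u c) : EvalsTo φ (-u) (-c) := by
  obtain ⟨a, b, hb, h1, h2⟩ := hu
  exact ⟨-a, b, hb, by simp [h1], by simp [h2]⟩

theorem sub (hu : EvalsTo φ u c) (hv : EvalsTo φ v d) : EvalsTo φ (u - v) (c - d) := by
  simpa only [sub_eq_add_neg] using hu.add hv.neg

variable [FaithfulSMul R U]

/-- This transfers inequalities from one drawing to the parameter field: a zero fraction has zero
numerator, as `R` embeds in `U`, and hence only the value 0. -/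
theorem ne_zero (hu : EvalsTo φ u c) (hc : c ≠ 0) : u ≠ 0 := by
  rintro rfl
  obtain ⟨a, b, hb, h1, h2⟩ := hu
  rw [zero_mul, eq_comm, FaithfulSMul.algebraMap_eq_zero_iff] at h1
  rw [h1, map_zero] at h2
  exact mul_ne_zero hc hb h2

theorem inv (hu : EvalsTo φ u c) (hc : c ≠ 0) : EvalsTo φ u⁻¹ c⁻¹ := by
  have hu0 := hu.ne_zero hc
  obtain ⟨a, b, hb, h1, h2⟩ := hu
  refine ⟨b, a, h2 ▸ mul_ne_zero hc hb, ?_, ?_⟩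
  · rw [← h1, inv_mul_cancel_left₀ hu0]
  · rw [← h2, inv_mul_cancel_left₀ hc]

theorem div (hu : EvalsTo φ u c) (hv : EvalsTo φ v d) (hd : d ≠ 0) :
    EvalsTo φ (u / v) (c / d) := by
  simpa only [div_eq_mul_inv] using hu.mul (hv.inv hd)

end EvalsTo

/-- Both coordinates of the point `u` are defined at the point given by `φ`, with the coordinates
of `c` as their values. -/
def PointEvalsTo (φ : R →+* L) (u : U × U) (c : L × L) : Prop :=
  EvalsTo φ u.1 c.1 ∧ EvalsTo φ u.2 c.2

namespace PointEvalsTo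

variable {φ : R →+* L} {u v u' v' : U × U} {c d c' d' : L × L}

theorem add (hu : PointEvalsTo φ u c) (hv : PointEvalsTo φ v d) :
    PointEvalsTo φ (u + v) (c + d) :=
  ⟨hu.1.add hv.1, hu.2.add hv.2⟩

theorem sub (hu : PointEvalsTo φ u c) (hv : PointEvalsTo φ v d) :
    PointEvalsTo φ (u - v) (c - d) :=
  ⟨hu.1.sub hv.1, hu.2.sub hv.2⟩

theorem smul {k : U} {l : L} (hk : EvalsTo φ k l) (hu : PointEvalsTo φ u c) :
    PointEvalsTo φ (k • u) (l • c) :=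
  ⟨hk.mul hu.1, hk.mul hu.2⟩

theorem planeDet (hu : PointEvalsTo φ u c) (hv : PointEvalsTo φ v d) :
    EvalsTo φ (planeDet u v) (planeDet c d) :=
  (hu.1.mul hv.2).sub (hu.2.mul hv.1)

variable [FaithfulSMul R U]

theorem ne (hu : PointEvalsTo φ u c) (hv : PointEvalsTo φ v d) (hcd : c ≠ d) : u ≠ v := by
  rintro rfl
  refine hcd (Prod.ext ?_ ?_)
  · by_contra h
    exact (hu.1.sub hv.1).ne_zero (sub_ne_zero.2 h) (sub_self _)
  · by_contra h
    exact (hu.2.sub hv.2).ne_zero (sub_ne_zero.2 h) (sub_self _)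

theorem lineIntersection (hu : PointEvalsTo φ u c) (hv : PointEvalsTo φ v d)
    (hu' : PointEvalsTo φ u' c') (hv' : PointEvalsTo φ v' d')
    (h : _root_.planeDet (d - c) (d' - c') ≠ 0) :
    PointEvalsTo φ (lineIntersection u v u' v') (lineIntersection c d c' d') :=
  hu.add (smul (((hu'.sub hu).planeDet (hv'.sub hu')).div ((hv.sub hu).planeDet (hv'.sub hu')) h)
    (hv.sub hu))

end PointEvalsTo

end EvalsTo

/-! ### The first two elements of a finite set -/

namespace Finset

variable {V : Type*} [LinearOrder V] {C : Finset V}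

theorem firstOf_eq_min' (hC : C.Nonempty) (v : V) : C.firstOf v = C.min' hC := by
  rw [firstOf, ← coe_min' hC, WithTop.untopD_coe]

theorem firstOf_mem (hC : C.Nonempty) (v : V) : C.firstOf v ∈ C :=
  firstOf_eq_min' hC v ▸ C.min'_mem hC

theorem firstOf_le {w : V} (hw : w ∈ C) (v : V) : C.firstOf v ≤ w :=
  firstOf_eq_min' ⟨w, hw⟩ v ▸ C.min'_le w hw

theorem firstOf_eq_firstOf (hC : C.Nonempty) (v w : V) : C.firstOf v = C.firstOf w := by
  rw [firstOf_eq_min' hC, firstOf_eq_min' hC]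

theorem erase_firstOf_nonempty (hC : 2 ≤ C.card) (v : V) : (C.erase (C.firstOf v)).Nonempty := by
  have h := C.pred_card_le_card_erase (a := C.firstOf v)
  exact card_pos.1 (by lia)

theorem secondOf_mem_erase (hC : 2 ≤ C.card) (v : V) : C.secondOf v ∈ C.erase (C.firstOf v) :=
  firstOf_mem (erase_firstOf_nonempty hC v) v

theorem secondOf_mem (hC : 2 ≤ C.card) (v : V) : C.secondOf v ∈ C :=
  mem_of_mem_erase (secondOf_mem_erase hC v)

theorem firstOf_lt_secondOf (hC : 2 ≤ C.card) (v : V) : C.firstOf v < C.secondOf v :=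
  (firstOf_le (secondOf_mem hC v) v).lt_of_ne (ne_of_mem_erase (secondOf_mem_erase hC v)).symm

theorem secondOf_eq_secondOf (hC : 2 ≤ C.card) (v w : V) : C.secondOf v = C.secondOf w := by
  have h : C.firstOf v = C.firstOf w := firstOf_eq_firstOf (card_pos.1 (by lia)) v w
  rw [secondOf, secondOf, ← h]
  exact firstOf_eq_firstOf (erase_firstOf_nonempty hC v) _ _

theorem secondOf_le {w : V} (hw : w ∈ C) (v : V) (hne : w ≠ C.firstOf v) : C.secondOf v ≤ w :=
  firstOf_le (mem_erase.2 ⟨hne, hw⟩) v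

/-- Otherwise the elements up to `v` would be among the first two. Hence the recursion for `v`
refers to earlier vertices only. -/
theorem secondOf_lt_of_three_le {v : V} (h : 3 ≤ (C.filter (· ≤ v)).card) : C.secondOf v < v := by
  by_contra! hle
  have hsub : C.filter (· ≤ v) ⊆ {C.firstOf v, C.secondOf v} := by
    intro w hw
    obtain ⟨hwC, hwv⟩ := mem_filter.1 hw
    rw [mem_insert, mem_singleton]
    by_cases hne : w = C.firstOf v
    · exact .inl hne
    · exact .inr ((hwv.trans hle).antisymm (secondOf_le hwC v hne))
  exact absurd (h.trans ((card_le_card hsub).trans card_le_two)) (by decide)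

theorem three_le_card_filter_le (hC : 2 ≤ C.card) {v : V} (hv : v ∈ C) (h1 : v ≠ C.firstOf v)
    (h2 : v ≠ C.secondOf v) : 3 ≤ (C.filter (· ≤ v)).card := by
  have hlt := firstOf_lt_secondOf hC v
  have hsub : {C.firstOf v, C.secondOf v, v} ⊆ C.filter (· ≤ v) := by
    intro w hw
    simp only [mem_insert, mem_singleton] at hw
    rcases hw with rfl | rfl | rfl
    · exact mem_filter.2 ⟨firstOf_mem (card_pos.1 (by lia)) v, firstOf_le hv v⟩
    · exact mem_filter.2 ⟨secondOf_mem hC v, secondOf_le hv v h1⟩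
    · exact mem_filter.2 ⟨hv, le_rfl⟩
  rw [← card_eq_three.2 ⟨_, _, _, hlt.ne, h1.symm, h2.symm, rfl⟩]
  exact card_le_card hsub

end Finset

/-! ### Lines of constraints and relevant constraints -/

namespace ConstrainedTriangulation

variable {V : Type*} [Fintype V]

/-- The lines of two constraints of a generic drawing that have a common vertex are not
parallel. -/
theorem IsGenericDrawing.planeDet_ne_zero {T : ConstrainedTriangulation V} {ρ : V → ℂ × ℂ}
    (hρ : T.IsGenericDrawing ρ) {C C' : Finset V} (hC : C ∈ T.constraints)
    (hC' : C' ∈ T.constraints) (hne : C ≠ C') {v a b a' b' : V} (hv : v ∈ C) (hv' : v ∈ C')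
    (ha : a ∈ C) (hb : b ∈ C) (hab : a ≠ b) (ha' : a' ∈ C') (hb' : b' ∈ C') (hab' : a' ≠ b') :
    planeDet (ρ b - ρ a) (ρ b' - ρ a') ≠ 0 := by
  -- Parallel lines with the common point `ρ v` coincide, against `lines_ne`: each point of `C'`
  -- differs from `ρ v` by a multiple of `ρ b' - ρ a'`, so it lies on the line of `C`.
  intro h
  have hl : ∀ x ∈ C, planeDet (ρ b - ρ a) (ρ x - ρ a) = 0 := fun x hx =>
    (hρ.collinear C hC).planeDet_eq_zero (Set.mem_image_of_mem ρ ha) (Set.mem_image_of_mem ρ hb)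
      (Set.mem_image_of_mem ρ hx)
  have hl' : ∀ x ∈ C', ∃ c : ℂ, ρ x = ρ a' + c • (ρ b' - ρ a') := fun x hx =>
    exists_eq_smul_of_planeDet_eq_zero (hρ.injective.ne hab')
      ((hρ.collinear C' hC').planeDet_eq_zero (Set.mem_image_of_mem ρ ha')
        (Set.mem_image_of_mem ρ hb') (Set.mem_image_of_mem ρ hx))
  refine hρ.lines_ne C hC C' hC' hne ⟨v, hv, hv'⟩
    (collinear_of_planeDet_eq_zero (hρ.injective.ne hab) ?_)
  rintro _ ⟨x, hx | hx, rfl⟩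
  · exact hl x hx
  · obtain ⟨c, hc⟩ := hl' x hx
    obtain ⟨d, hd⟩ := hl' v hv'
    have h1 := hl v hv
    rw [hd] at h1
    rw [hc]
    simp only [planeDet, Prod.fst_sub, Prod.snd_sub, Prod.fst_add, Prod.snd_add, Prod.smul_fst,
      Prod.smul_snd, smul_eq_mul] at h h1 ⊢
    linear_combination h1 + (c - d) * h

variable [LinearOrder V] {T : ConstrainedTriangulation V} {C C' : Finset V} {v : V}

theorem mem_relevant :
    C ∈ T.relevant v ↔ C ∈ T.constraints ∧ v ∈ C ∧ 3 ≤ (C.filter (· ≤ v)).card :=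
  Finset.mem_filter

theorem two_le_card_of_mem_relevant (h : C ∈ T.relevant v) : 2 ≤ C.card :=
  (Nat.le_succ 2).trans ((mem_relevant.1 h).2.2.trans (Finset.card_filter_le _ _))

theorem firstOf_mem_of_mem_relevant (h : C ∈ T.relevant v) : C.firstOf v ∈ C :=
  Finset.firstOf_mem ⟨v, (mem_relevant.1 h).2.1⟩ v

theorem secondOf_mem_of_mem_relevant (h : C ∈ T.relevant v) : C.secondOf v ∈ C :=
  Finset.secondOf_mem (two_le_card_of_mem_relevant h) v

theorem firstOf_lt_secondOf_of_mem_relevant (h : C ∈ T.relevant v) :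
    C.firstOf v < C.secondOf v :=
  Finset.firstOf_lt_secondOf (two_le_card_of_mem_relevant h) v

theorem secondOf_lt_of_mem_relevant (h : C ∈ T.relevant v) : C.secondOf v < v :=
  Finset.secondOf_lt_of_three_le (mem_relevant.1 h).2.2

theorem firstOf_lt_of_mem_relevant (h : C ∈ T.relevant v) : C.firstOf v < v :=
  (firstOf_lt_secondOf_of_mem_relevant h).trans (secondOf_lt_of_mem_relevant h)

/-! ### The recursion for the parameterization -/

/-- The default value 0 at vertices not before `v` is harmless, since `place` consults only earlier
vertices when the order is a drawing order. The lemmas for the separate cases remove it. -/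
theorem parameterization_eq_place (v : V) :
    T.parameterization v = T.place v fun w => if w < v then T.parameterization w else 0 := by
  rw [parameterization, WellFoundedLT.fix_eq]
  rfl

theorem parameterization_corner (hv : v = T.p ∨ v = T.q ∨ v = T.s) :
    T.parameterization v = (T.param v 0, T.param v 1) := by
  rw [parameterization_eq_place, place, if_pos hv]

theorem IsDrawingOrder.lt (h : T.IsDrawingOrder) : T.p < T.q ∧ T.q < T.s ∧ T.s < T.r := by
  have hnd := T.corners_nodup
  simp only [List.nodup_cons, List.mem_cons, List.not_mem_nil, not_or, or_false] at hnd
  exact ⟨h.p_le_q.lt_of_ne hnd.1.1, h.q_le_s.lt_of_ne hnd.2.1.2,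
    h.s_le_r.lt_of_ne (Ne.symm hnd.2.2.1)⟩

theorem parameterization_r (h : T.IsDrawingOrder) :
    T.parameterization T.r =
      T.parameterization T.q + T.parameterization T.s - T.parameterization T.p := by
  obtain ⟨h1, h2, h3⟩ := h.lt
  rw [parameterization_eq_place, place, if_neg, if_pos rfl]
  · simp only [h3, h2.trans h3, (h1.trans h2).trans h3, if_true]
  · rintro (h | h | h)
    · exact ((h1.trans h2).trans h3).ne' h
    · exact (h2.trans h3).ne' h
    · exact h3.ne' h

theorem parameterization_of_relevant_nil (hv : ¬ (v = T.p ∨ v = T.q ∨ v = T.s)) (hr : v ≠ T.r)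
    (h : (T.relevant v).toList = []) : T.parameterization v = (T.param v 0, T.param v 1) := by
  rw [parameterization_eq_place, place, if_neg hv, if_neg hr, h]

theorem parameterization_of_relevant_singleton (hv : ¬ (v = T.p ∨ v = T.q ∨ v = T.s))
    (hr : v ≠ T.r) (h : (T.relevant v).toList = [C]) :
    T.parameterization v = T.param v 0 • T.parameterization (C.firstOf v) +
      (1 - T.param v 0) • T.parameterization (C.secondOf v) := by
  have hC : C ∈ T.relevant v := by simp [← Finset.mem_toList, h]
  rw [parameterization_eq_place, place, if_neg hv, if_neg hr, h]
  simp only [firstOf_lt_of_mem_relevant hC, secondOf_lt_of_mem_relevant hC, if_true]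

theorem parameterization_of_relevant_pair (hv : ¬ (v = T.p ∨ v = T.q ∨ v = T.s))
    (hr : v ≠ T.r) (h : (T.relevant v).toList = [C, C']) :
    T.parameterization v =
      lineIntersection (T.parameterization (C.firstOf v)) (T.parameterization (C.secondOf v))
        (T.parameterization (C'.firstOf v)) (T.parameterization (C'.secondOf v)) := by
  have hC : C ∈ T.relevant v := by simp [← Finset.mem_toList, h]
  have hC' : C' ∈ T.relevant v := by simp [← Finset.mem_toList, h]
  rw [parameterization_eq_place, place, if_neg hv, if_neg hr, h]
  simp only [firstOf_lt_of_mem_relevant hC, secondOf_lt_of_mem_relevant hC,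
    firstOf_lt_of_mem_relevant hC', secondOf_lt_of_mem_relevant hC', if_true]

/-- Nonnegativity of `alpha v` allows at most two relevant constraints, so the fallback case of
`place` does not occur. -/
theorem IsDrawingOrder.relevant_cases (h : T.IsDrawingOrder)
    (hv : ¬ (v = T.p ∨ v = T.q ∨ v = T.s)) (hr : v ≠ T.r) :
    (T.relevant v).toList = [] ∨ (∃ C, (T.relevant v).toList = [C]) ∨
      ∃ C C', C ≠ C' ∧ (T.relevant v).toList = [C, C'] := by
  have h0 : 0 ≤ T.alpha v := by
    simp only [not_or] at hv
    exact h.alpha_nonneg v hv.1 hv.2.1 hr hv.2.2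
  rw [alpha, if_neg hv, if_neg hr, ← Finset.length_toList] at h0
  have hnd := (T.relevant v).nodup_toList
  match hl : (T.relevant v).toList with
  | [] => exact .inl rfl
  | [C] => exact .inr (.inl ⟨C, rfl⟩)
  | [C, C'] =>
    rw [hl] at hnd
    exact .inr (.inr ⟨C, C', by simpa using hnd, rfl⟩)
  | _ :: _ :: _ :: _ =>
    rw [hl] at h0
    simp only [List.length_cons] at h0
    push_cast at h0
    lia

/-! ### Generic drawings are values of the parameterization -/

theorem toNat_alpha_corner (hv : v = T.p ∨ v = T.q ∨ v = T.s) : (T.alpha v).toNat = 2 := by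
  rw [alpha, if_pos hv]
  rfl

theorem toNat_alpha_of_relevant (hv : ¬ (v = T.p ∨ v = T.q ∨ v = T.s)) (hr : v ≠ T.r)
    {l : List (Finset V)} (h : (T.relevant v).toList = l) : (T.alpha v).toNat = 2 - l.length := by
  rw [alpha, if_neg hv, if_neg hr, ← Finset.length_toList, h]
  lia

/-- These are the parameter values that reproduce the drawing: the coordinates of a free vertex, and
the affine ratio of a vertex that is bound to one line. -/
theorem exists_parameter_values {ρ : V → ℂ × ℂ} (hρ : T.IsGenericDrawing ρ) :
    ∃ c : V → ℕ → ℂ,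
      (∀ v, (v = T.p ∨ v = T.q ∨ v = T.s) ∨ (T.relevant v).toList = [] →
        c v 0 = (ρ v).1 ∧ c v 1 = (ρ v).2) ∧
      ∀ v C, ¬ (v = T.p ∨ v = T.q ∨ v = T.s) → (T.relevant v).toList = [C] →
        ρ v = c v 0 • ρ (C.firstOf v) + (1 - c v 0) • ρ (C.secondOf v) := by
  suffices ∀ v, ∃ c : ℕ → ℂ,
      ((v = T.p ∨ v = T.q ∨ v = T.s) ∨ (T.relevant v).toList = [] →
        c 0 = (ρ v).1 ∧ c 1 = (ρ v).2) ∧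
      ∀ C, ¬ (v = T.p ∨ v = T.q ∨ v = T.s) → (T.relevant v).toList = [C] →
        ρ v = c 0 • ρ (C.firstOf v) + (1 - c 0) • ρ (C.secondOf v) by
    choose c hc using this
    exact ⟨c, fun v => (hc v).1, fun v => (hc v).2⟩
  intro v
  by_cases h : (v = T.p ∨ v = T.q ∨ v = T.s) ∨ (T.relevant v).toList = []
  · refine ⟨fun i => if i = 0 then (ρ v).1 else (ρ v).2, fun _ => ⟨rfl, rfl⟩, fun C h1 h2 => ?_⟩
    rcases h with h | h
    · exact absurd h h1
    · simp [h] at h2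
  · by_cases hs : ∃ C, (T.relevant v).toList = [C]
    · obtain ⟨C, hC⟩ := hs
      have hmem : C ∈ T.relevant v := by simp [← Finset.mem_toList, hC]
      obtain ⟨hCT, hvC, -⟩ := mem_relevant.1 hmem
      obtain ⟨d, hd⟩ := exists_eq_smul_of_planeDet_eq_zero
        (hρ.injective.ne (firstOf_lt_secondOf_of_mem_relevant hmem).ne)
        ((hρ.collinear C hCT).planeDet_eq_zero
          (Set.mem_image_of_mem ρ (firstOf_mem_of_mem_relevant hmem))
          (Set.mem_image_of_mem ρ (secondOf_mem_of_mem_relevant hmem))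
          (Set.mem_image_of_mem ρ hvC))
      -- `d` is the coefficient of the second point, whereas the parameter is the coefficient of the
      -- first.
      refine ⟨fun _ => 1 - d, fun h' => absurd h' h, fun C' _ hC' => ?_⟩
      obtain rfl : C = C' := by simpa [hC] using hC'
      rw [hd]
      module
    · exact ⟨fun _ => 0, fun h' => absurd h' h, fun C _ hC => absurd ⟨C, hC⟩ hs⟩

theorem evalsTo_param (c : V → ℕ → ℂ) {i : ℕ} (hi : i < (T.alpha v).toNat) :
    EvalsTo (MvPolynomial.eval₂Hom (algebraMap ℚ ℂ) fun x : T.Parameter => c x.1 x.2)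
      (T.param v i) (c v i) := by
  rw [param, dif_pos hi]
  simpa using EvalsTo.of_algebraMap (U := T.ParameterField)
    (MvPolynomial.eval₂Hom (algebraMap ℚ ℂ) fun x : T.Parameter => c x.1 x.2)
    (MvPolynomial.X ⟨v, ⟨i, hi⟩⟩)

/-- Induction along the order. Denominators arise only from intersecting two relevant lines; these
lines meet at `ρ v` and are distinct in the drawing, so the determinant has a nonzero value there.
-/
theorem IsGenericDrawing.exists_pointEvalsTo {ρ : V → ℂ × ℂ} (hρ : T.IsGenericDrawing ρ)
    (hord : T.IsDrawingOrder) :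
    ∃ φ : MvPolynomial T.Parameter ℚ →+* ℂ, ∀ v, PointEvalsTo φ (T.parameterization v) (ρ v) := by
  obtain ⟨c, hc2, hc1⟩ := exists_parameter_values hρ
  refine ⟨MvPolynomial.eval₂Hom (algebraMap ℚ ℂ) fun x => c x.1 x.2, fun v => ?_⟩
  induction v using WellFoundedLT.induction with
  | ind v ih =>
  by_cases hv : v = T.p ∨ v = T.q ∨ v = T.s
  · rw [parameterization_corner hv, PointEvalsTo, ← (hc2 v (.inl hv)).1, ← (hc2 v (.inl hv)).2]
    exact ⟨evalsTo_param c (by simp [toNat_alpha_corner hv]),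
      evalsTo_param c (by simp [toNat_alpha_corner hv])⟩
  by_cases hr : v = T.r
  · subst hr
    obtain ⟨h1, h2, h3⟩ := hord.lt
    rw [parameterization_r hord, eq_sub_of_add_eq' hρ.parallelogram]
    exact ((ih _ (h2.trans h3)).add (ih _ h3)).sub (ih _ ((h1.trans h2).trans h3))
  rcases hord.relevant_cases hv hr with h | ⟨C, h⟩ | ⟨C, C', hne, h⟩
  · have ha := toNat_alpha_of_relevant hv hr h
    rw [parameterization_of_relevant_nil hv hr h, PointEvalsTo, ← (hc2 v (.inr h)).1,
      ← (hc2 v (.inr h)).2]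
    exact ⟨evalsTo_param c (by simp [ha]), evalsTo_param c (by simp [ha])⟩
  · have hC : C ∈ T.relevant v := by simp [← Finset.mem_toList, h]
    have hp := evalsTo_param (T := T) (v := v) c (i := 0)
      (by simp [toNat_alpha_of_relevant hv hr h])
    rw [parameterization_of_relevant_singleton hv hr h, hc1 v C hv h]
    exact (PointEvalsTo.smul hp (ih _ (firstOf_lt_of_mem_relevant hC))).add
      (PointEvalsTo.smul (EvalsTo.one.sub hp) (ih _ (secondOf_lt_of_mem_relevant hC)))
  · have hC : C ∈ T.relevant v := by simp [← Finset.mem_toList, h]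
    have hC' : C' ∈ T.relevant v := by simp [← Finset.mem_toList, h]
    have hd := hρ.planeDet_ne_zero (mem_relevant.1 hC).1 (mem_relevant.1 hC').1 hne
      (mem_relevant.1 hC).2.1 (mem_relevant.1 hC').2.1 (firstOf_mem_of_mem_relevant hC)
      (secondOf_mem_of_mem_relevant hC) (firstOf_lt_secondOf_of_mem_relevant hC).ne
      (firstOf_mem_of_mem_relevant hC') (secondOf_mem_of_mem_relevant hC')
      (firstOf_lt_secondOf_of_mem_relevant hC').ne
    have hline : ∀ D ∈ T.relevant v,
        planeDet (ρ (D.secondOf v) - ρ (D.firstOf v)) (ρ v - ρ (D.firstOf v)) = 0 := fun D hD =>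
      (hρ.collinear D (mem_relevant.1 hD).1).planeDet_eq_zero
        (Set.mem_image_of_mem ρ (firstOf_mem_of_mem_relevant hD))
        (Set.mem_image_of_mem ρ (secondOf_mem_of_mem_relevant hD))
        (Set.mem_image_of_mem ρ (mem_relevant.1 hD).2.1)
    rw [parameterization_of_relevant_pair hv hr h,
      eq_lineIntersection hd (hline C hC) (hline C' hC')]
    exact (ih _ (firstOf_lt_of_mem_relevant hC)).lineIntersection
      (ih _ (secondOf_lt_of_mem_relevant hC)) (ih _ (firstOf_lt_of_mem_relevant hC'))
      (ih _ (secondOf_lt_of_mem_relevant hC')) hd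

/-! ### The parameterization satisfies the constraints -/

/-- A constraint contains at most two corners, so it is relevant to interior vertices only. -/
theorem IsGenericDrawing.not_corner_of_mem_relevant {ρ : V → ℂ × ℂ} (hρ : T.IsGenericDrawing ρ)
    (hord : T.IsDrawingOrder) (hC : C ∈ T.relevant v) :
    ¬ (v = T.p ∨ v = T.q ∨ v = T.s) ∧ v ≠ T.r := by
  obtain ⟨hCT, hvC, -⟩ := mem_relevant.1 hC
  have hy := firstOf_mem_of_mem_relevant hC
  have hz := secondOf_mem_of_mem_relevant hC
  have hyz := firstOf_lt_secondOf_of_mem_relevant hC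
  have hzv := secondOf_lt_of_mem_relevant hC
  generalize C.firstOf v = y at hy hyz
  generalize C.secondOf v = z at hz hyz hzv
  obtain ⟨h1, h2, h3⟩ := hord.lt
  obtain ⟨n1, n2, n3, n4⟩ := hρ.nondegenerate
  have hcol : ∀ a b c, a ∈ C → b ∈ C → c ∈ C → Collinear ℂ {ρ a, ρ b, ρ c} := by
    intro a b c ha hb hc
    refine (hρ.collinear C hCT).subset ?_
    rintro _ (rfl | rfl | rfl)
    exacts [Set.mem_image_of_mem ρ ha, Set.mem_image_of_mem ρ hb, Set.mem_image_of_mem ρ hc]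
  have hcor : ∀ w, w < T.r → w = T.p ∨ w = T.q ∨ w = T.s := by
    intro w hw
    by_contra hne
    simp only [not_or] at hne
    exact hw.not_ge (hord.r_le w hne.1 hne.2.1 hne.2.2)
  -- If `v` were a corner, then `v ≤ r`, and the two earlier vertices `y < z` of `C` would be
  -- corners as well. Three collinear corners contradict nondegeneracy.
  by_contra hcon
  have hvr : v ≤ T.r := by
    rcases not_and_or.1 hcon with h | h
    · rcases not_not.1 h with rfl | rfl | rfl
      exacts [((h1.trans h2).trans h3).le, (h2.trans h3).le, h3.le]
    · exact (not_not.1 h).le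
  have hz' := hcor z (hzv.trans_le hvr)
  have hy' := hcor y (hyz.trans (hzv.trans_le hvr))
  have hv' : (v = T.p ∨ v = T.q ∨ v = T.s) ∨ v = T.r := by
    rcases hvr.lt_or_eq with h | h
    exacts [.inl (hcor v h), .inr h]
  by_cases hp : T.p ∈ C <;> by_cases hq : T.q ∈ C <;> by_cases hr : T.r ∈ C <;>
    by_cases hs : T.s ∈ C <;>
    first
    | exact n1 (hcol _ _ _ hp hq hr)
    | exact n2 (hcol _ _ _ hq hr hs)
    | exact n3 (hcol _ _ _ hr hs hp)
    | exact n4 (hcol _ _ _ hs hp hq)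
    | grind

/-- With one relevant constraint this holds by construction. With two, the second line requires a
nonzero Cramer denominator, which is obtained by evaluating at the drawing. -/
theorem IsGenericDrawing.planeDet_parameterization_eq_zero {ρ : V → ℂ × ℂ}
    (hρ : T.IsGenericDrawing ρ) (hord : T.IsDrawingOrder) (hC : C ∈ T.relevant v) :
    planeDet (T.parameterization (C.secondOf v) - T.parameterization (C.firstOf v))
      (T.parameterization v - T.parameterization (C.firstOf v)) = 0 := by
  obtain ⟨hv, hr⟩ := hρ.not_corner_of_mem_relevant hord hC
  rcases hord.relevant_cases hv hr with h | ⟨D, h⟩ | ⟨D, D', hne, h⟩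
  · simp [← Finset.mem_toList, h] at hC
  · obtain rfl : C = D := by simpa [← Finset.mem_toList, h] using hC
    rw [parameterization_of_relevant_singleton hv hr h]
    simp only [planeDet, Prod.fst_sub, Prod.snd_sub, Prod.fst_add, Prod.snd_add, Prod.smul_fst,
      Prod.smul_snd, smul_eq_mul]
    ring
  · have hD : D ∈ T.relevant v := by simp [← Finset.mem_toList, h]
    have hD' : D' ∈ T.relevant v := by simp [← Finset.mem_toList, h]
    have hd := hρ.planeDet_ne_zero (mem_relevant.1 hD).1 (mem_relevant.1 hD').1 hne
      (mem_relevant.1 hD).2.1 (mem_relevant.1 hD').2.1 (firstOf_mem_of_mem_relevant hD)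
      (secondOf_mem_of_mem_relevant hD) (firstOf_lt_secondOf_of_mem_relevant hD).ne
      (firstOf_mem_of_mem_relevant hD') (secondOf_mem_of_mem_relevant hD')
      (firstOf_lt_secondOf_of_mem_relevant hD').ne
    obtain ⟨φ, hφ⟩ := hρ.exists_pointEvalsTo hord
    rw [parameterization_of_relevant_pair hv hr h]
    have hCD : C = D ∨ C = D' := by simpa [← Finset.mem_toList, h] using hC
    rcases hCD with rfl | rfl
    · exact planeDet_lineIntersection_left _ _ _ _
    · exact planeDet_lineIntersection_right
        ((((hφ _).sub (hφ _)).planeDet ((hφ _).sub (hφ _))).ne_zero hd)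

/-- All points of a constraint that contains the triangle lie on the line through its first two
points. These are distinct in the parameter field because they are distinct in the drawing. -/
theorem IsGenericDrawing.area_parameterization_eq_zero {ρ : V → ℂ × ℂ}
    (hρ : T.IsGenericDrawing ρ) (hord : T.IsDrawingOrder) {t : T.Triangle} (ht : ¬ T.IsAlive t) :
    T.area T.parameterization t = 0 := by
  simp only [IsAlive, not_forall, not_not] at ht
  obtain ⟨C, hCT, htC⟩ := ht
  have hcard : 2 ≤ C.card := (Nat.le_succ 2).trans (t.2.2.symm.trans_le (Finset.card_le_card htC))
  have hne : C.Nonempty := Finset.card_pos.1 (two_pos.trans_le hcard)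
  obtain ⟨φ, hφ⟩ := hρ.exists_pointEvalsTo hord
  -- The argument `T.p` is a dummy: `C` has at least two elements, so the default is never used.
  set y := C.firstOf T.p
  set z := C.secondOf T.p
  have hyz : T.parameterization y ≠ T.parameterization z :=
    (hφ y).ne (hφ z) (hρ.injective.ne (Finset.firstOf_lt_secondOf hcard T.p).ne)
  have hline : ∀ v ∈ C, planeDet (T.parameterization z - T.parameterization y)
      (T.parameterization v - T.parameterization y) = 0 := by
    intro v hv
    by_cases h1 : v = y
    · simp [h1, planeDet]
    by_cases h2 : v = z
    · simp only [h2, planeDet]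
      ring
    have ey : y = C.firstOf v := Finset.firstOf_eq_firstOf hne _ _
    have ez : z = C.secondOf v := Finset.secondOf_eq_secondOf hcard _ _
    rw [ey] at h1 ⊢
    rw [ez] at h2 ⊢
    -- A vertex of `C` other than the first two comes after them, so `C` is relevant to it.
    exact hρ.planeDet_parameterization_eq_zero hord
      (mem_relevant.2 ⟨hCT, hv, Finset.three_le_card_filter_le hcard hv h1 h2⟩)
  have hmem : ∀ i, T.orient t i ∈ C := fun i => htC ((T.mem_iff_orient t _).2 ⟨i, rfl⟩)
  exact triangleArea_eq_zero_of_mem_line hyz (hline _ (hmem 0)) (hline _ (hmem 1))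
    (hline _ (hmem 2))

end ConstrainedTriangulation

/-! ### Specialization of the coordinate functions -/

/-- Writing the area with the constant 1/2 instead of a division makes it an element of the
polynomial ring, so that it can be carried along ring homomorphisms. -/
theorem map_half_mul_planeDet {R K : Type*} [CommRing R] [Algebra ℚ R] [Field K] [NeZero (2 : K)]
    (h : R →+* K) (a b c : R × R) :
    h (algebraMap ℚ R (1 / 2) * ((b.1 - a.1) * (c.2 - a.2) - (b.2 - a.2) * (c.1 - a.1))) =
      triangleArea (Prod.map h h a) (Prod.map h h b) (Prod.map h h c) := by
  have h2 : h (algebraMap ℚ R (1 / 2)) * 2 = 1 := by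
    rw [← map_ofNat (h.comp (algebraMap ℚ R)) 2, ← RingHom.comp_apply, ← map_mul]
    norm_num
  rw [triangleArea, eq_div_iff two_ne_zero, map_mul, mul_right_comm, h2, one_mul]
  simp [planeDet]

namespace SquareTriangulation

variable {V : Type*} [Fintype V] (T : SquareTriangulation V)

/-- The coordinate functions can be specialized to the coordinates of any points of which the
corners form a parallelogram. -/
theorem exists_specialization {K : Type*} [Field K] [Algebra ℚ K] [NeZero (2 : K)] (P : V → K × K)
    (hP : P T.r = P T.q + P T.s - P T.p) :
    ∃ (ψ : MvPolynomial ({v : V // v ≠ T.r} × Fin 2) ℚ →+* K)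
      (a : T.Triangle → MvPolynomial ({v : V // v ≠ T.r} × Fin 2) ℚ),
      (∀ t, algebraMap _ T.CoordinateField (a t) = T.Z t) ∧ ∀ t, ψ (a t) = T.area P t := by
  classical
  let R := MvPolynomial ({v : V // v ≠ T.r} × Fin 2) ℚ
  -- `F` and `G` lift `freePoint` and `coordinatePoint` to the polynomial ring. The specialization
  -- `ψ` is defined there, but in general not on the field of fractions.
  let F : V → R × R := fun v => if h : v ≠ T.r then
    (MvPolynomial.X (⟨v, h⟩, 0), MvPolynomial.X (⟨v, h⟩, 1)) else 0
  let G : V → R × R := fun v => if v = T.r then F T.q + F T.s - F T.p else F v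
  let ψ : R →+* K := MvPolynomial.eval₂Hom (algebraMap ℚ K) fun x =>
    if x.2 = 0 then (P x.1).1 else (P x.1).2
  have hnd := T.corners_nodup
  simp only [List.nodup_cons, List.mem_cons, List.not_mem_nil, not_or, or_false] at hnd
  have hFψ : ∀ v, v ≠ T.r → Prod.map ψ ψ (F v) = P v := by
    intro v hv
    simp only [F, dif_pos hv]
    exact Prod.ext ((MvPolynomial.eval₂Hom_X' _ _ _).trans (if_pos rfl))
      ((MvPolynomial.eval₂Hom_X' _ _ _).trans (if_neg one_ne_zero))
  have hGψ : ∀ v, Prod.map ψ ψ (G v) = P v := by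
    intro v
    by_cases hv : v = T.r
    · rw [hv, hP, ← hFψ T.q hnd.2.1.1, ← hFψ T.s (Ne.symm hnd.2.2.1), ← hFψ T.p hnd.1.2.1]
      simp [G, Prod.ext_iff]
    · simp only [G, if_neg hv, hFψ v hv]
  let ι : R →+* T.CoordinateField := algebraMap _ _
  have hFι : ∀ v, Prod.map ι ι (F v) = T.freePoint v := by
    intro v
    by_cases hv : v = T.r
    · simp [F, hv, freePoint, Prod.ext_iff]
    · simp only [F, freePoint, dif_pos hv]
      rfl
  have hGι : ∀ v, Prod.map ι ι (G v) = T.coordinatePoint v := by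
    intro v
    by_cases hv : v = T.r
    · rw [coordinatePoint, if_pos hv, ← hFι, ← hFι, ← hFι]
      simp [G, hv, Prod.ext_iff]
    · simp only [G, if_neg hv, hFι, coordinatePoint]
  refine ⟨ψ, fun t => algebraMap ℚ R (1 / 2) *
    (((G (T.orient t 1)).1 - (G (T.orient t 0)).1) * ((G (T.orient t 2)).2 - (G (T.orient t 0)).2) -
    ((G (T.orient t 1)).2 - (G (T.orient t 0)).2) * ((G (T.orient t 2)).1 - (G (T.orient t 0)).1)),
    fun t => ?_, fun t => ?_⟩
  · rw [Z, area, ← hGι, ← hGι, ← hGι]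
    exact map_half_mul_planeDet ι _ _ _
  · rw [area, ← hGψ, ← hGψ, ← hGψ]
    exact map_half_mul_planeDet ψ _ _ _

/-- Both sides come from the polynomial ring, which embeds in its field of fractions. The equation
therefore holds among polynomials and can be specialized. -/
theorem eval₂_area_of_eval₂_Z {K : Type*} [Field K] [Algebra ℚ K] [NeZero (2 : K)] (P : V → K × K)
    (hP : P T.r = P T.q + P T.s - P T.p) {f : MvPolynomial T.Triangle ℤ} {e : ℕ}
    (h : 2 * MvPolynomial.eval₂ (Int.castRingHom T.CoordinateField) T.Z f = (∑ t, T.Z t) ^ e) :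
    2 * MvPolynomial.eval₂ (Int.castRingHom K) (T.area P) f = (∑ t, T.area P t) ^ e := by
  obtain ⟨ψ, a, hZ, hψ⟩ := T.exists_specialization P hP
  have hmap : ∀ {L : Type _} [CommRing L] (g : MvPolynomial ({v : V // v ≠ T.r} × Fin 2) ℚ →+* L),
      g (MvPolynomial.eval₂ (Int.castRingHom _) a f) =
        MvPolynomial.eval₂ (Int.castRingHom L) (fun t => g (a t)) f := by
    intro L _ g
    rw [MvPolynomial.eval₂_comp_left, RingHom.eq_intCast' (g.comp _)]
    rfl
  have key : 2 * MvPolynomial.eval₂ (Int.castRingHom _) a f = (∑ t, a t) ^ e := by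
    apply IsFractionRing.injective (MvPolynomial ({v : V // v ≠ T.r} × Fin 2) ℚ) T.CoordinateField
    rw [map_mul, map_ofNat, hmap, map_pow, map_sum]
    simpa only [hZ] using h
  have := congrArg ψ key
  rw [map_mul, map_ofNat, map_pow, map_sum, MvPolynomial.eval₂_comp_left,
    RingHom.eq_intCast' (ψ.comp _)] at this
  simpa only [Function.comp_def, hψ] using this

end SquareTriangulation

/-! ### Setting the dead variables to zero -/

namespace ConstrainedTriangulation

variable {V : Type*} [Fintype V] (T : ConstrainedTriangulation V)

theorem isHomogeneous_killDead {f : MvPolynomial T.Triangle ℤ} {d : ℕ} (hf : f.IsHomogeneous d) :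
    (T.killDead f).IsHomogeneous d := by
  have := hf.aeval (S := ℤ) (n := 1) (fun t : T.Triangle => open Classical in
    if h : T.IsAlive t then (MvPolynomial.X ⟨t, h⟩ : MvPolynomial T.LivingTriangle ℤ) else 0) ?_
  · rwa [one_mul] at this
  · intro t
    split_ifs with h
    · exact MvPolynomial.isHomogeneous_X _ _
    · exact MvPolynomial.isHomogeneous_zero _ _ _

theorem eval₂_killDead {K : Type*} [CommRing K] (w : T.Triangle → K)
    (hw : ∀ t, ¬ T.IsAlive t → w t = 0) (f : MvPolynomial T.Triangle ℤ) :
    MvPolynomial.eval₂ (Int.castRingHom K) (fun t : T.LivingTriangle => w t.1) (T.killDead f) =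
      MvPolynomial.eval₂ (Int.castRingHom K) w f := by
  let θ := MvPolynomial.eval₂Hom (Int.castRingHom K) fun t : T.LivingTriangle => w t.1
  change θ (T.killDead f) = _
  rw [killDead, MvPolynomial.aeval_def, MvPolynomial.eval₂_comp_left, RingHom.eq_intCast' (θ.comp _)]
  congr 1
  funext t
  rw [Function.comp_apply]
  split_ifs with h
  · exact MvPolynomial.eval₂Hom_X' _ _ _
  · rw [map_zero, hw t h]

theorem sum_living {K : Type*} [AddCommMonoid K] (w : T.Triangle → K)
    (hw : ∀ t, ¬ T.IsAlive t → w t = 0) : ∑ t : T.LivingTriangle, w t.1 = ∑ t, w t := by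
  classical
  rw [← Finset.sum_subtype (Finset.univ.filter T.IsAlive) (by simp) w]
  exact Finset.sum_filter_of_ne fun t _ h => not_not.1 fun ht => h (hw t ht)

end ConstrainedTriangulation

theorem mainTheorem2 {V : Type*} [Fintype V] [LinearOrder V] (T : ConstrainedTriangulation V)
    (hT : T.Drawable) (hord : T.IsDrawingOrder) :
    (∃ (f : MvPolynomial T.LivingTriangle ℤ) (e : ℕ), f.IsHomogeneous e ∧
      2 * MvPolynomial.eval₂ (Int.castRingHom T.ParameterField) T.W f = (∑ t, T.W t) ^ e) ∧
    (∃ (fT : MvPolynomial T.Triangle ℤ) (e : ℕ), fT.IsHomogeneous e ∧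
      2 * MvPolynomial.eval₂ (Int.castRingHom T.CoordinateField) T.Z fT = (∑ t, T.Z t) ^ e) ∧
    (∀ (fT : MvPolynomial T.Triangle ℤ) (d e : ℕ), fT.IsHomogeneous d →
      2 * MvPolynomial.eval₂ (Int.castRingHom T.CoordinateField) T.Z fT = (∑ t, T.Z t) ^ e →
      (T.killDead fT).IsHomogeneous d ∧
        2 * MvPolynomial.eval₂ (Int.castRingHom T.ParameterField) T.W (T.killDead fT) =
          (∑ t, T.W t) ^ e) := by
  obtain ⟨ρ, hρ⟩ := hT
  have h3 : ∀ (fT : MvPolynomial T.Triangle ℤ) (d e : ℕ), fT.IsHomogeneous d →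
      2 * MvPolynomial.eval₂ (Int.castRingHom T.CoordinateField) T.Z fT = (∑ t, T.Z t) ^ e →
      (T.killDead fT).IsHomogeneous d ∧
        2 * MvPolynomial.eval₂ (Int.castRingHom T.ParameterField) T.W (T.killDead fT) =
          (∑ t, T.W t) ^ e := by
    intro fT d e hd he
    have hdead : ∀ t, ¬ T.IsAlive t → T.area T.parameterization t = 0 := fun t ht =>
      hρ.area_parameterization_eq_zero hord ht
    refine ⟨T.isHomogeneous_killDead hd, ?_⟩
    have := T.eval₂_area_of_eval₂_Z T.parameterization
      (ConstrainedTriangulation.parameterization_r hord) he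
    rwa [← T.sum_living _ hdead, ← T.eval₂_killDead _ hdead] at this
  have h2 : ∃ (fT : MvPolynomial T.Triangle ℤ) (e : ℕ), fT.IsHomogeneous e ∧
      2 * MvPolynomial.eval₂ (Int.castRingHom T.CoordinateField) T.Z fT = (∑ t, T.Z t) ^ e := by
    refine T.exists_monsky_polynomial T.coordinatePoint ?_
    have hnd := T.corners_nodup
    simp only [List.nodup_cons, List.mem_cons, List.not_mem_nil, not_or, or_false] at hnd
    simp only [SquareTriangulation.coordinatePoint, if_true, if_neg hnd.2.1.1,
      if_neg (Ne.symm hnd.2.2.1), if_neg hnd.1.2.1]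
  obtain ⟨fT, e, hhom, heq⟩ := h2
  -- The polynomial for the living triangles is `T.killDead fT`.
  exact ⟨⟨_, e, h3 fT e e hhom heq⟩, ⟨fT, e, hhom, heq⟩, h3⟩
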